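/- Let $V$ be a finite-dimensional real vector space, $R=\mathbb{R}[[V^*]]$ the ring of formal power series on $V$ (i.e. $R=\mathbb R[[x_i : i\in\iota]]$ in linear coordinates on $V$), $I\subset R$ the ideal of series with vanishing constant term, and let $\mathfrak{k}$ be a compact simple real Lie algebra. Let $\mathfrak{g}=R\otimes\mathfrak{k}$ with bracket $[f\otimes X,g\otimes Y]=fg\otimes[X,Y]$ and the product topology (coefficientwise convergence), let $\mathrm{ev}_0:\mathfrak g\to\mathfrak k$ be evaluation at the origin, and regard $\mathfrak{k}\subset\mathfrak{g}$ as the constant series. Let $\mathcal{X}_I$ be the Lie algebra of formal vector fields on $V$ vanishing at $0$, identified via the Lie derivative $v\mapsto\mathcal L_v$ with the Lie algebra of derivations of $R$ preserving $I$; $\mathcal L_v$ acts on $\mathfrak g$ as $\mathcal L_v\otimes\mathrm{id}_{\mathfrak k}$. Let $\mathfrak{p}$ be a finite-dimensional semisimple real Lie algebra, and let $\boldsymbol{v}:\mathfrak{p}\to\mathcal{X}_I^{\mathrm{op}}$ be a Lie algebra homomorphism, i.e. $\boldsymbol v$ is linear with $\boldsymbol v([p,q])=[\boldsymbol v(q),\boldsymbol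 v(p)]$. A linear map $\sigma:\mathfrak{p}\to\mathfrak{g}$ is said to satisfy the Maurer–Cartan equation if $$-\mathcal{L}_{\boldsymbol v(p)}\sigma(q)+\mathcal{L}_{\boldsymbol v(q)}\sigma(p)-\sigma([p,q])+[\sigma(p),\sigma(q)]=0\qquad\text{for all }p,q\in\mathfrak{p}.$$ Two linear maps $\sigma,\eta:\mathfrak{p}\to\mathfrak{g}$ satisfying this equation are called gauge-equivalent if there is $\xi\in\mathfrak{g}$ with $$\eta(p)=e^{\mathrm{ad}_\xi}\sigma(p)+F(\mathrm{ad}_\xi)\bigl(-\mathcal{L}_{\boldsymbol v(p)}\xi\bigr)\qquad\text{for all }p\in\mathfrak{p},$$ where $F(w)=-\sum_{n\ge 0}\frac{1}{(n+1)!}w^n$ and both operator series are evaluated as convergent series in $\mathfrak g$. **Theorem.** Let the linear map $\sigma:\mathfrak{p}\to\mathfrak{g}$ satisfy the Maurer–Cartan equation. Then $\sigma_0:=\mathrm{ev}_0\circ\sigma:\mathfrak{p}\to\mathfrak{k}$ is a homomorphism of Lie algebras, and $\sigma$ is gauge-equivalent to $\sigma_0$. If, moreover, $\mathfrak{p}$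 has no non-zero compact ideal, then $\sigma$ is gauge-equivalent to $0$. Here a finite-dimensional real Lie algebra is called compact if it admits an inner product for which all operators $\mathrm{ad}_x$ are skew-symmetric. -/

import Mathlib

open scoped TensorProduct Nat

noncomputable section

namespace JetAlgebra

/-- The ring `R = ℝ⟦V*⟧` of formal power series on the finite-dimensional real vector space `V`,
written in the linear coordinates `(x_i)_{i ∈ ι}` given by a basis of `V`. -/
abbrev FormalSeries (ι : Type*) := MvPowerSeries ι ℝ

/-- The Lie algebra `𝔤 = R ⊗ 𝔨`, with bracket `[f ⊗ X, g ⊗ Y] = fg ⊗ [X, Y]`. -/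
abbrev Jet (ι : Type*) (𝔨 : Type*) [LieRing 𝔨] [LieAlgebra ℝ 𝔨] := FormalSeries ι ⊗[ℝ] 𝔨

/-- The Lie algebra `𝒳_I` of formal vector fields vanishing at the origin. A vector field is
identified with its Lie derivative: an element is a derivation of `R` that preserves the
ideal `I` of power series without constant term, and the bracket is the commutator. (Such a
derivation is automatically `f ↦ ∑ i, v_i ∂f/∂x_i`, with `v_i ∈ I` its value at `x_i`.) -/
def VectorFields (ι : Type*) : LieSubalgebra ℝ (Derivation ℝ (FormalSeries ι) (FormalSeries ι)) where
  carrier := {D | ∀ f : FormalSeries ι,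
    MvPowerSeries.constantCoeff f = 0 → MvPowerSeries.constantCoeff (D f) = 0}
  add_mem' := by
    intro D E hD hE f hf
    simp [hD f hf, hE f hf]
  zero_mem' := by
    intro f _
    simp
  smul_mem' := by
    intro c D hD f hf
    simp [hD f hf]
  lie_mem' := by
    intro D E hD hE f hf
    rw [Derivation.commutator_apply, map_sub, hD _ (hE f hf), hE _ (hD f hf), sub_zero]

variable {ι : Type*} {𝔨 𝔭 : Type*} [LieRing 𝔨] [LieAlgebra ℝ 𝔨] [LieRing 𝔭] [LieAlgebra ℝ 𝔭]

/-- The Lie derivative `ℒ_v = ℒ_v ⊗ id` on `𝔤 = R ⊗ 𝔨`. -/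
def lieDeriv (v : VectorFields ι) : Jet ι 𝔨 →ₗ[ℝ] Jet ι 𝔨 :=
  LinearMap.rTensor 𝔨 (v : Derivation ℝ (FormalSeries ι) (FormalSeries ι)).toLinearMap

/-- The `m`-th coefficient, an element of `𝔨`, of a `𝔨`-valued formal power series. -/
def coeffAt (m : ι →₀ ℕ) : Jet ι 𝔨 →ₗ[ℝ] 𝔨 :=
  (TensorProduct.lid ℝ 𝔨).toLinearMap ∘ₗ LinearMap.rTensor 𝔨 (MvPowerSeries.coeff m)

/-- Evaluation at the origin, `ev₀ : 𝔤 → 𝔨`. -/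
def ev₀ : Jet ι 𝔨 →ₗ[ℝ] 𝔨 := coeffAt 0

/-- The inclusion `X ↦ 1 ⊗ X` of `𝔨` into `𝔤` as the constant power series. -/
def const : 𝔨 →ₗ[ℝ] Jet ι 𝔨 := TensorProduct.mk ℝ (FormalSeries ι) 𝔨 1

/-- The product topology on `𝔤`: convergence of every coefficient in `𝔨`, where the
finite-dimensional space `𝔨` has its canonical vector space topology. -/
instance jetTopology : TopologicalSpace (Jet ι 𝔨) :=
  ⨅ m : ι →₀ ℕ, TopologicalSpace.induced (coeffAt m) (moduleTopology ℝ 𝔨)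

/-- The Maurer-Cartan equation
`-ℒ_{v(p)} σ(q) + ℒ_{v(q)} σ(p) - σ([p, q]) + [σ(p), σ(q)] = 0`. -/
def MaurerCartan (v : 𝔭 →ₗ[ℝ] VectorFields ι) (σ : 𝔭 →ₗ[ℝ] Jet ι 𝔨) : Prop :=
  ∀ p q : 𝔭, -lieDeriv (v p) (σ q) + lieDeriv (v q) (σ p) - σ ⁅p, q⁆ + ⁅σ p, σ q⁆ = 0

/-- `η = e^{ad ξ} ξ'`, as the sum of a convergent series in `𝔤`. -/
def IsExpAd (ξ ξ' η : Jet ι 𝔨) : Prop :=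
  HasSum (fun n : ℕ => (n ! : ℝ)⁻¹ • ((LieAlgebra.ad (FormalSeries ι) (Jet ι 𝔨) ξ) ^ n) ξ') η

/-- `η = F(ad ξ) ξ'` with `F(w) = -∑ₙ wⁿ / (n + 1)!`, as the sum of a convergent series in `𝔤`. -/
def IsFAd (ξ ξ' η : Jet ι 𝔨) : Prop :=
  HasSum (fun n : ℕ => -(((n + 1)! : ℝ)⁻¹ •
    ((LieAlgebra.ad (FormalSeries ι) (Jet ι 𝔨) ξ) ^ n) ξ')) η

/-- Gauge equivalence of two solutions `σ`, `η` of the Maurer-Cartan equation: for some `ξ ∈ 𝔤`,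
`η(p) = e^{ad ξ} σ(p) + F(ad ξ)(-ℒ_{v(p)} ξ)` for all `p`. -/
def GaugeEquivalent (v : 𝔭 →ₗ[ℝ] VectorFields ι) (σ η : 𝔭 →ₗ[ℝ] Jet ι 𝔨) : Prop :=
  MaurerCartan v σ ∧ MaurerCartan v η ∧
    ∃ ξ : Jet ι 𝔨, ∀ p : 𝔭, ∃ a b : Jet ι 𝔨,
      IsExpAd ξ (σ p) a ∧ IsFAd ξ (-lieDeriv (v p) ξ) b ∧ η p = a + b

/-- A (finite-dimensional) real Lie algebra is compact if it carries an inner product for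
which all `ad x` are skew-symmetric. -/
def IsCompactLieAlgebra (L : Type*) [LieRing L] [LieAlgebra ℝ L] : Prop :=
  ∃ B : LinearMap.BilinForm ℝ L, B.IsSymm ∧ (∀ x : L, x ≠ 0 → 0 < B x x) ∧
    ∀ x y z : L, B ⁅x, y⁆ z = -B y ⁅x, z⁆

end JetAlgebra

end

/-! Let `𝔭` act on `𝔤` by `p ↦ -ℒ_{v(p)}`. A linear map `σ` solves the Maurer–Cartan equation if and
only if `p ↦ (σ p, p)` is a homomorphism from `𝔭` to the semidirect sum `𝔤 ⋊ 𝔭`, and the gauge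
action of `ξ` is conjugation of this homomorphism by `exp (ad (ξ, 0))`. Two homomorphisms from a
semisimple Lie algebra that agree modulo jets vanishing at the origin are conjugate: one corrects
the conjugating element successively along the filtration of `𝔤` by the order of vanishing. At each
step the obstruction is a 1-cocycle of `𝔭` in a finite-dimensional module, hence a coboundary by
Whitehead's first lemma, which in turn rests on the Casimir operator.

Finally, if `𝔨` is compact, then so is a complement of the ideal `ker σ₀`, because it embeds in `𝔨`;
without non-zero compact ideals this forces `σ₀ = 0`. -/

section Semisimple

variable {K L M : Type*} [Field K] [LieRing L] [LieAlgebra K L] [AddCommGroup M] [Module K M]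

lemma lie_self_eq_of_isSemisimple [LieAlgebra.IsSemisimple K L] (I : LieIdeal K L) :
    ⁅I, I⁆ = I := by
  refine le_antisymm (LieSubmodule.lie_le_left I I) ?_
  obtain ⟨C, hC⟩ := exists_isCompl (⁅I, I⁆ : LieIdeal K L)
  have hIC : I ⊓ C = ⊥ := by
    apply (LieAlgebra.hasTrivialRadical_iff_no_abelian_ideals K L).mp inferInstance
    rw [LieSubmodule.lie_abelian_iff_lie_self_eq_bot, eq_bot_iff, ← hC.inf_eq_bot]
    exact le_inf (LieSubmodule.mono_lie inf_le_left inf_le_left)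
      ((LieSubmodule.lie_le_left _ _).trans inf_le_right)
  calc I = I ⊓ (⁅I, I⁆ ⊔ C) := by rw [hC.sup_eq_top, inf_top_eq]
    _ = (I ⊓ ⁅I, I⁆) ⊔ (I ⊓ C) := inf_sup_left _ _ _
    _ ≤ (⁅I, I⁆ : LieIdeal K L) := by rw [hIC, sup_bot_eq]; exact inf_le_right

lemma derivedSeries_one_eq_top [LieAlgebra.IsSemisimple K L] :
    LieAlgebra.derivedSeries K L 1 = ⊤ :=
  lie_self_eq_of_isSemisimple (K := K) (L := L) ⊤

lemma linearMap_eq_zero_of_map_lie_eq_zero [LieAlgebra.IsSemisimple K L] (c : L →ₗ[K] M)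
    (hc : ∀ x y : L, c ⁅x, y⁆ = 0) : c = 0 := by
  have hspan := LieSubmodule.lieIdeal_oper_eq_linear_span' (⊤ : LieIdeal K L) (⊤ : LieIdeal K L)
  rw [lie_self_eq_of_isSemisimple, LieSubmodule.top_toSubmodule] at hspan
  rw [← LinearMap.ker_eq_top, eq_top_iff, hspan, Submodule.span_le]
  rintro _ ⟨x, -, y, -, rfl⟩
  exact hc x y

variable [LieRingModule L M] [LieModule K L M]

lemma isNilpotent_of_traceForm_eq_zero [CharZero K] [LieAlgebra.IsSemisimple K L]
    [FiniteDimensional K M] (h : LieModule.traceForm K L M = 0) : LieModule.IsNilpotent L M := by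
  have hn := LieModule.isNilpotent_derivedSeries_of_traceForm_eq_zero h
  rw [LieModule.isNilpotent_iff_forall' (R := K)] at hn ⊢
  exact fun x ↦ hn ⟨x, by rw [derivedSeries_one_eq_top]; trivial⟩

lemma isTrivial_of_traceForm_eq_zero [CharZero K] [LieAlgebra.IsSemisimple K L]
    [FiniteDimensional K M] [LieModule.IsIrreducible K L M] (h : LieModule.traceForm K L M = 0) :
    LieModule.IsTrivial L M := by
  have := isNilpotent_of_traceForm_eq_zero h
  have := LieModule.nontrivial_of_isIrreducible K L M
  have := LieModule.nontrivial_max_triv_of_isNilpotent K L M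
  rw [LieModule.isTrivial_iff_max_triv_eq_top K]
  exact LieSubmodule.eq_top_of_isIrreducible K L M _

lemma exists_lieIdeal_nondegenerate_of_traceForm_ne_zero [LieAlgebra.IsSemisimple K L]
    (h : LieModule.traceForm K L M ≠ 0) : ∃ J : LieIdeal K L, J ≠ ⊥ ∧
      ∃ Φ : LinearMap.BilinForm K J, Φ.Nondegenerate ∧ Φ.lieInvariant L ∧
        ∀ x y : J, Φ x y = LieModule.traceForm K L M x y := by
  have hsymm := LieModule.traceForm_isSymm K L M
  have hinv := LieModule.traceForm_lieInvariant K L M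
  let I := LieAlgebra.InvariantForm.orthogonal (LieModule.traceForm K L M) hinv ⊤
  have hI : I.toSubmodule = LinearMap.ker (LieModule.traceForm K L M) := by
    ext y
    simp [I, LinearMap.ext_iff, LieModule.traceForm_comm K L M y]
  obtain ⟨J, hJ⟩ := exists_isCompl I
  refine ⟨J, ?_, (LieModule.traceForm K L M).restrict J.toSubmodule,
    hsymm.nondegenerate_restrict_of_isCompl_ker ?_, fun x y z ↦ hinv x y z, fun _ _ ↦ rfl⟩
  · rintro rfl
    refine h (LinearMap.ker_eq_top.mp ?_)
    rw [← hI, eq_top_of_isCompl_bot hJ, LieSubmodule.top_toSubmodule]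
  · exact hI ▸ (LieSubmodule.isCompl_toSubmodule.mpr hJ).symm

end Semisimple

section Casimir

open LieModule LinearMap.BilinForm

variable {K L N M P ι : Type*} [Field K] [LieRing L]
  [AddCommGroup N] [Module K N] [LieRingModule L N]
  [AddCommGroup M] [Module K M] [LieRingModule L M]
  [AddCommGroup P] [Module K P] [Fintype ι] [DecidableEq ι]

lemma sum_dualBasis_lie_add_sum_lie_basis_eq_zero {Φ : LinearMap.BilinForm K N}
    (hΦ : Φ.Nondegenerate) (hinv : Φ.lieInvariant L) (b : Module.Basis ι K N)
    (f : N →ₗ[K] N →ₗ[K] P) (x : L) :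
    ∑ i, f ⁅x, Φ.dualBasis hΦ b i⁆ (b i) + ∑ i, f (Φ.dualBasis hΦ b i) ⁅x, b i⁆ = 0 := by
  set b' := Φ.dualBasis hΦ b
  have coord_eq (j) : b.coord j = Φ (b' j) := by
    refine b.ext fun i ↦ ?_
    simp [b', apply_dualBasis_left, Finsupp.single_apply]
  have lie_dual (i) : ⁅x, b' i⁆ = ∑ j, -Φ (b' i) ⁅x, b j⁆ • b' j := by
    rw [← b'.sum_repr ⁅x, b' i⁆]
    simp only [b', dualBasis_repr_apply, hinv x]
  have lie_basis (i) : ⁅x, b i⁆ = ∑ j, Φ (b' j) ⁅x, b i⁆ • b j := by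
    simp only [← coord_eq, b.coord_apply, b.sum_repr]
  calc _ = ∑ i, ∑ j, -Φ (b' i) ⁅x, b j⁆ • f (b' j) (b i) +
        ∑ i, ∑ j, Φ (b' j) ⁅x, b i⁆ • f (b' i) (b j) := by
          congr 1 <;> refine Finset.sum_congr rfl fun i _ ↦ ?_
          · rw [lie_dual, map_sum, LinearMap.sum_apply]
            simp only [map_smul, LinearMap.smul_apply]
          · conv_lhs => rw [lie_basis, map_sum]
            simp only [map_smul]
    _ = 0 := by
      rw [Finset.sum_comm, ← Finset.sum_add_distrib]
      simp only [neg_smul, Finset.sum_neg_distrib, neg_add_cancel, Finset.sum_const_zero]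

variable [LieAlgebra K L] [LieModule K L M]

lemma d₁₂_eq_zero_iff {c : Cohomology.oneCochain K L M} :
    Cohomology.d₁₂ K L M c = 0 ↔ ∀ x y, c ⁅x, y⁆ = ⁅x, c y⁆ - ⁅y, c x⁆ := by
  refine ⟨fun h x y ↦ ?_, fun h ↦ ?_⟩
  · rw [eq_comm, ← sub_eq_zero, ← Cohomology.d₁₂_apply_apply, h]
    rfl
  · ext x y
    simp [h x y]

section

variable {J : LieIdeal K L} {Φ : LinearMap.BilinForm K J} (hΦ : Φ.Nondegenerate)
  (hinv : Φ.lieInvariant L) (b : Module.Basis ι K J)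

include hinv in
lemma sum_dualBasis_lie_lie_of_d₁₂_eq_zero {c : Cohomology.oneCochain K L M}
    (hc : Cohomology.d₁₂ K L M c = 0) (x : L) :
    ∑ i, ⁅(Φ.dualBasis hΦ b i : L), ⁅(b i : L), c x⁆⁆ =
      ⁅x, ∑ i, ⁅(Φ.dualBasis hΦ b i : L), c (b i)⁆⁆ := by
  rw [d₁₂_eq_zero_iff] at hc
  let f : J →ₗ[K] J →ₗ[K] M := LinearMap.mk₂ K (fun y z ↦ ⁅(y : L), c z⁆)
    (by simp) (by simp) (by simp) (by simp)
  have hf := sum_dualBasis_lie_add_sum_lie_basis_eq_zero hΦ hinv b f x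
  simp only [f, LinearMap.mk₂_apply, LieSubmodule.coe_bracket, hc x, lie_sub,
    Finset.sum_sub_distrib] at hf
  rw [lie_sum]
  simp only [leibniz_lie x (Φ.dualBasis hΦ b _ : L), Finset.sum_add_distrib]
  rw [← sub_eq_zero, ← neg_eq_zero, ← hf]
  abel

variable (M) in
/-- The Casimir operator `∑ i, b' i ∘ b i` on the Lie module `M`, where `b` is a basis of the ideal
`J` and `b'` its dual basis with respect to a nondegenerate invariant bilinear form on `J`. -/
noncomputable def casimir : M →ₗ⁅K, L⁆ M where
  toLinearMap := ∑ i, toEnd K L M (Φ.dualBasis hΦ b i) * toEnd K L M (b i)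
  map_lie' {x m} := by
    let c : L →ₗ[K] M := (toEnd K L M : L →ₗ[K] M →ₗ[K] M).flip m
    have hc : Cohomology.d₁₂ K L M c = 0 := d₁₂_eq_zero_iff.mpr fun y z ↦ by simp [c]
    simpa [c, LinearMap.sum_apply] using sum_dualBasis_lie_lie_of_d₁₂_eq_zero hΦ hinv b hc x

lemma casimir_apply (m : M) :
    casimir M hΦ hinv b m = ∑ i, ⁅(Φ.dualBasis hΦ b i : L), ⁅(b i : L), m⁆⁆ :=
  LinearMap.sum_apply ..

end

lemma trace_casimir {J : LieIdeal K L} (b : Module.Basis ι K J)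
    {Φ : LinearMap.BilinForm K J} (hΦ : Φ.Nondegenerate) (hinv : Φ.lieInvariant L)
    (h : ∀ x y : J, Φ x y = traceForm K L M x y) :
    LinearMap.trace K M (casimir M hΦ hinv b) = Module.finrank K J := by
  have trace_term (i) : LinearMap.trace K M
      (toEnd K L M (Φ.dualBasis hΦ b i) * toEnd K L M (b i)) = 1 := by
    have hi := apply_dualBasis_left hΦ b i i
    rwa [if_pos rfl, h] at hi
  rw [Module.finrank_eq_card_basis b]
  simp [casimir, trace_term]

end Casimir

section Whitehead

open LieModule

variable (K L M : Type*) [Field K] [LieRing L] [LieAlgebra K L]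
  [AddCommGroup M] [Module K M] [LieRingModule L M] [LieModule K L M]

/-- The vanishing of the first cohomology `H¹(L, M)`: every 1-cocycle is a coboundary `⁅·, m⁆`. -/
def HasVanishingFirstCohomology : Prop :=
  ∀ c : Cohomology.oneCochain K L M, Cohomology.d₁₂ K L M c = 0 → ∃ m, ∀ x, c x = ⁅x, m⁆

variable {K L M}

namespace HasVanishingFirstCohomology

lemma of_isTrivial [LieAlgebra.IsSemisimple K L] [IsTrivial L M] :
    HasVanishingFirstCohomology K L M := fun c hc ↦ by
  refine ⟨0, fun x ↦ ?_⟩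
  rw [linearMap_eq_zero_of_map_lie_eq_zero c fun x y ↦ by
    simp only [d₁₂_eq_zero_iff.mp hc, trivial_lie_zero, sub_zero],
    LinearMap.zero_apply, lie_zero]

lemma of_traceForm_ne_zero [CharZero K] [FiniteDimensional K L] [LieAlgebra.IsSemisimple K L]
    [FiniteDimensional K M] [IsIrreducible K L M] (h : traceForm K L M ≠ 0) :
    HasVanishingFirstCohomology K L M := fun c hc ↦ by
  obtain ⟨J, hJ, Φ, hΦ, hinv, hΦ_eq⟩ := exists_lieIdeal_nondegenerate_of_traceForm_ne_zero h
  let b := Module.finBasis K J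
  let Ω := casimir M hΦ hinv b
  have Ω_ne_zero : Ω ≠ 0 := fun h0 ↦ hJ <| by
    have htrace := trace_casimir b hΦ hinv hΦ_eq
    rw [show (casimir M hΦ hinv b : M →ₗ[K] M) = 0 from congrArg _ h0, map_zero, eq_comm,
      Nat.cast_eq_zero] at htrace
    exact (LieSubmodule.toSubmodule_eq_bot J).mp (Submodule.finrank_eq_zero.mp htrace)
  have Ω_injective : Function.Injective Ω := by
    rw [← LieModuleHom.ker_eq_bot]
    refine (eq_bot_or_eq_top Ω.ker).resolve_right fun htop ↦ Ω_ne_zero ?_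
    ext m
    exact LieModuleHom.mem_ker.mp (htop ▸ LieSubmodule.mem_top m)
  obtain ⟨m, hm⟩ := LinearMap.injective_iff_surjective (f := (Ω : M →ₗ[K] M)).mp Ω_injective
    (∑ i, ⁅(Φ.dualBasis hΦ b i : L), c (b i)⁆)
  refine ⟨m, fun x ↦ Ω_injective ?_⟩
  calc Ω (c x) = ⁅x, ∑ i, ⁅(Φ.dualBasis hΦ b i : L), c (b i)⁆⁆ := by
        rw [casimir_apply, sum_dualBasis_lie_lie_of_d₁₂_eq_zero hΦ hinv b hc x]
    _ = Ω ⁅x, m⁆ := by rw [← hm, LieModuleHom.coe_toLinearMap, LieModuleHom.map_lie]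

lemma of_isIrreducible [CharZero K] [FiniteDimensional K L] [LieAlgebra.IsSemisimple K L]
    [FiniteDimensional K M] [IsIrreducible K L M] : HasVanishingFirstCohomology K L M := by
  by_cases h : traceForm K L M = 0
  · have := isTrivial_of_traceForm_eq_zero h
    exact of_isTrivial
  · exact of_traceForm_ne_zero h

lemma of_quotient {N : LieSubmodule K L M} (hN : HasVanishingFirstCohomology K L N)
    (hquot : HasVanishingFirstCohomology K L (M ⧸ N)) : HasVanishingFirstCohomology K L M := by
  intro c hc
  rw [d₁₂_eq_zero_iff] at hc
  obtain ⟨m', hm'⟩ := hquot ((LieSubmodule.Quotient.mk' N : M →ₗ[K] M ⧸ N) ∘ₗ c) <|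
    d₁₂_eq_zero_iff.mpr fun x y ↦ by
      simp only [LinearMap.comp_apply, LieModuleHom.coe_toLinearMap, hc, map_sub,
        LieModuleHom.map_lie]
  obtain ⟨m, rfl⟩ := LieSubmodule.Quotient.surjective_mk' N m'
  let d : L →ₗ[K] M := c - (toEnd K L M : L →ₗ[K] M →ₗ[K] M).flip m
  have hd (x) : d x = c x - ⁅x, m⁆ := rfl
  have d_cocycle (x y) : d ⁅x, y⁆ = ⁅x, d y⁆ - ⁅y, d x⁆ := by
    simp only [hd, hc, lie_sub, lie_lie]
    abel
  have d_mem (x) : d x ∈ N := by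
    rw [hd, ← LieSubmodule.Quotient.mk_eq_zero, map_sub, sub_eq_zero, LieModuleHom.map_lie]
    exact hm' x
  obtain ⟨n, hn⟩ := hN (d.codRestrict (N : Submodule K M) d_mem) <|
    d₁₂_eq_zero_iff.mpr fun x y ↦ Subtype.ext (d_cocycle x y)
  refine ⟨m + n, fun x ↦ ?_⟩
  rw [lie_add, ← sub_eq_iff_eq_add', ← hd]
  exact congrArg Subtype.val (hn x)

/-- **Whitehead's first lemma**. -/
theorem of_isSemisimple [CharZero K] [FiniteDimensional K L] [LieAlgebra.IsSemisimple K L]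
    [FiniteDimensional K M] : HasVanishingFirstCohomology K L M := by
  induction hn : Module.finrank K M using Nat.strong_induction_on generalizing M with
  | _ n ih =>
  subst hn
  cases subsingleton_or_nontrivial M
  · exact fun c _ ↦ ⟨0, fun x ↦ Subsingleton.elim _ _⟩
  by_cases hM : IsIrreducible K L M
  · exact of_isIrreducible
  obtain ⟨N, hbot, htop⟩ : ∃ N : LieSubmodule K L M, N ≠ ⊥ ∧ N ≠ ⊤ := by
    contrapose! hM
    exact IsIrreducible.mk hM
  have hsum := Submodule.finrank_quotient_add_finrank (N : Submodule K M)
  have hpos : 0 < Module.finrank K N := by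
    rw [Nat.pos_iff_ne_zero]
    exact fun h ↦ hbot ((LieSubmodule.toSubmodule_eq_bot N).mp (Submodule.finrank_eq_zero.mp h))
  refine of_quotient (N := N) (ih _ (Submodule.finrank_lt ?_) rfl) (ih _ (?_ : _ < _) rfl)
  · exact fun h ↦ htop ((LieSubmodule.toSubmodule_eq_top N).mp h)
  · exact hsum ▸ Nat.lt_add_of_pos_right hpos

end HasVanishingFirstCohomology

lemma exists_lie_sModEq_of_cocycle [CharZero K] [FiniteDimensional K L]
    [LieAlgebra.IsSemisimple K L] (A B : LieSubmodule K L M) [FiniteDimensional K (M ⧸ B)]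
    (c : L →ₗ[K] M) (hA : ∀ x, c x ∈ A)
    (hc : ∀ x y, c ⁅x, y⁆ ≡ ⁅x, c y⁆ - ⁅y, c x⁆ [SMOD B.toSubmodule]) :
    ∃ m ∈ A, ∀ x, c x ≡ ⁅x, m⁆ [SMOD B.toSubmodule] := by
  let π := LieSubmodule.Quotient.mk' B
  let c' : L →ₗ[K] A.map π := ((π : M →ₗ[K] M ⧸ B) ∘ₗ c).codRestrict (A.map π).toSubmodule
    fun x ↦ LieSubmodule.mem_map_of_mem (hA x)
  obtain ⟨⟨_, m, hm, rfl⟩, hcm⟩ := HasVanishingFirstCohomology.of_isSemisimple c' <|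
    d₁₂_eq_zero_iff.mpr fun x y ↦ Subtype.ext (hc x y)
  exact ⟨m, hm, fun x ↦ congrArg Subtype.val (hcm x)⟩

end Whitehead

section LieFiltration

open LieAlgebra Finset

variable {K L S : Type*} [Field K] [LieRing L] [LieAlgebra K L] [LieRing S] [LieAlgebra K S]

/-- A decreasing filtration `S = G 0 ⊇ G 1 ⊇ ⋯` of a Lie algebra by subspaces that is
compatible with the bracket. -/
structure IsLieFiltration (G : ℕ → Submodule K S) : Prop where
  zero : G 0 = ⊤
  anti : Antitone G
  lie_mem : ∀ {i j x y}, x ∈ G i → y ∈ G j → ⁅x, y⁆ ∈ G (i + j)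

/-- A filtration of a Lie algebra with finite-dimensional quotients `S ⧸ G k` in which successive
approximations converge. Limits need not be unique: `⨅ k, G k = ⊥` is not required. -/
structure IsProfiniteLieFiltration (G : ℕ → Submodule K S) : Prop extends IsLieFiltration G where
  finiteDimensional_quotient : ∀ k, FiniteDimensional K (S ⧸ G k)
  exists_limit : ∀ u : ℕ → S, (∀ k, u (k + 1) ≡ u k [SMOD G (k + 1)]) →
    ∃ z, ∀ k, z ≡ u k [SMOD G (k + 1)]

variable (K) in
/-- The partial sum `∑ n < N, (ad z) ^ n / n!` of the exponential series of `ad z`. -/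
def truncatedExpAd (N : ℕ) (z : S) : S →ₗ[K] S :=
  ∑ n ∈ range N, (n ! : K)⁻¹ • ad K S z ^ n

lemma truncatedExpAd_apply (N : ℕ) (z x : S) :
    truncatedExpAd K N z x = ∑ n ∈ range N, (n ! : K)⁻¹ • (ad K S z ^ n) x := by
  simp [truncatedExpAd]

lemma ad_pow_succ_apply (z x : S) (n : ℕ) :
    (ad K S z ^ (n + 1)) x = ⁅z, (ad K S z ^ n) x⁆ := by
  rw [pow_succ', Module.End.mul_apply, ad_apply]

lemma inv_factorial_smul_ad_pow_lie [CharZero K] (z x y : S) (n : ℕ) :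
    (n ! : K)⁻¹ • (ad K S z ^ n) ⁅x, y⁆ = ∑ i ∈ range (n + 1),
      ⁅(i ! : K)⁻¹ • (ad K S z ^ i) x, ((n - i)! : K)⁻¹ • (ad K S z ^ (n - i)) y⁆ := by
  have leibniz := LieDerivation.iterate_apply_lie (LieDerivation.ad K S z) n x y
  have coe_ad : ⇑(LieDerivation.ad K S z) = ⇑(ad K S z) := by ext; simp
  simp only [coe_ad, ← Module.End.pow_apply] at leibniz
  rw [leibniz, smul_sum, Nat.sum_antidiagonal_eq_sum_range_succ_mk]
  refine sum_congr rfl fun i hi ↦ ?_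
  have hin : i ≤ n := Nat.lt_succ_iff.mp (mem_range.mp hi)
  rw [← Nat.cast_smul_eq_nsmul K, smul_lie, lie_smul, smul_smul, smul_smul, Nat.cast_choose K hin]
  congr 1
  have := Nat.cast_ne_zero (R := K).mpr n.factorial_ne_zero
  field_simp

namespace IsLieFiltration

variable {G : ℕ → Submodule K S} (hG : IsLieFiltration G)
include hG

lemma mem_zero (x : S) : x ∈ G 0 := hG.zero ▸ trivial

lemma lie_sModEq_lie {i j : ℕ} {x y y' : S} (hx : x ∈ G i) (hy : y ≡ y' [SMOD G j]) :
    ⁅x, y⁆ ≡ ⁅x, y'⁆ [SMOD G (i + j)] := by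
  rw [SModEq.sub_mem, ← lie_sub]
  exact hG.lie_mem hx (SModEq.sub_mem.mp hy)

lemma ad_pow_mem {z : S} (hz : z ∈ G 1) (x : S) (n : ℕ) : (ad K S z ^ n) x ∈ G n := by
  induction n with
  | zero => exact hG.mem_zero _
  | succ n ih =>
    rw [ad_pow_succ_apply, add_comm]
    exact hG.lie_mem hz ih

lemma truncatedExpAd_sModEq_of_le {z : S} (hz : z ∈ G 1) {M N : ℕ} (h : M ≤ N) (x : S) :
    truncatedExpAd K N z x ≡ truncatedExpAd K M z x [SMOD G M] := by
  rw [SModEq.sub_mem, truncatedExpAd_apply, truncatedExpAd_apply, ← sum_range_add_sum_Ico _ h,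
    add_sub_cancel_left]
  exact sum_mem fun n hn ↦ Submodule.smul_mem _ _ <|
    hG.anti (mem_Ico.mp hn).1 (hG.ad_pow_mem hz x n)

lemma truncatedExpAd_lie_sModEq [CharZero K] {z : S} (hz : z ∈ G 1) (N : ℕ) (x y : S) :
    truncatedExpAd K N z ⁅x, y⁆ ≡ ⁅truncatedExpAd K N z x, truncatedExpAd K N z y⁆
      [SMOD G N] := by
  have sum_rows : truncatedExpAd K N z ⁅x, y⁆ = ∑ i ∈ range N,
      ⁅(i ! : K)⁻¹ • (ad K S z ^ i) x, truncatedExpAd K (N - i) z y⁆ := by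
    simp only [truncatedExpAd_apply, inv_factorial_smul_ad_pow_lie, lie_sum]
    exact sum_range_diag_flip N fun i j ↦
      ⁅(i ! : K)⁻¹ • (ad K S z ^ i) x, (j ! : K)⁻¹ • (ad K S z ^ j) y⁆
  rw [sum_rows, truncatedExpAd_apply N z x, _root_.sum_lie]
  refine SModEq.sum fun i hi ↦ ?_
  have tail := hG.lie_sModEq_lie (Submodule.smul_mem _ (i ! : K)⁻¹ (hG.ad_pow_mem hz x i))
    (hG.truncatedExpAd_sModEq_of_le hz (Nat.sub_le N i) y)
  rw [Nat.add_sub_cancel' (mem_range.mp hi).le] at tail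
  exact tail.symm

lemma ad_add_pow_sModEq {z d : S} {k : ℕ} (hz : z ∈ G 1) (hd : d ∈ G (k + 1)) (x : S) (n : ℕ) :
    (ad K S (z + d) ^ (n + 1)) x ≡ (ad K S z ^ (n + 1)) x [SMOD G (k + 1 + n)] := by
  have lie_d (n) : ⁅d, (ad K S z ^ n) x⁆ ≡ 0 [SMOD G (k + 1 + n)] :=
    SModEq.zero.mpr (hG.lie_mem hd (hG.ad_pow_mem hz x n))
  have drop_d (n) :
      ⁅z + d, (ad K S z ^ n) x⁆ ≡ (ad K S z ^ (n + 1)) x [SMOD G (k + 1 + n)] := by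
    rw [add_lie, ← ad_pow_succ_apply]
    simpa only [add_zero] using (SModEq.refl _).add (lie_d n)
  induction n with
  | zero => simpa using drop_d 0
  | succ n ih =>
    have hzd : z + d ∈ G 1 := add_mem hz (hG.anti (Nat.le_add_left 1 k) hd)
    have step := hG.lie_sModEq_lie hzd ih
    rw [← ad_pow_succ_apply, add_comm 1] at step
    exact step.trans (drop_d (n + 1))

lemma truncatedExpAd_add_sModEq {z d : S} {k : ℕ} (hz : z ∈ G 1) (hd : d ∈ G (k + 1)) (x : S)
    (N : ℕ) : truncatedExpAd K N (z + d) x ≡ truncatedExpAd K N z x [SMOD G (k + 1)] := by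
  simp only [truncatedExpAd_apply]
  refine SModEq.sum fun n _ ↦ SModEq.smul ?_ _
  cases n with
  | zero => rfl
  | succ n => exact (hG.ad_add_pow_sModEq hz hd x n).mono (hG.anti (Nat.le_add_right _ n))

lemma truncatedExpAd_add_sModEq_add_lie {z d : S} {k : ℕ} (hz : z ∈ G 1) (hd : d ∈ G (k + 1))
    (x : S) (N : ℕ) : truncatedExpAd K (N + 2) (z + d) x ≡
      truncatedExpAd K (N + 2) z x + ⁅d, x⁆ [SMOD G (k + 2)] := by
  have higher_terms : ∑ n ∈ range N, ((n + 2)! : K)⁻¹ • (ad K S (z + d) ^ (n + 2)) x ≡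
      ∑ n ∈ range N, ((n + 2)! : K)⁻¹ • (ad K S z ^ (n + 2)) x [SMOD G (k + 2)] :=
    SModEq.sum fun n _ ↦ SModEq.smul
      ((hG.ad_add_pow_sModEq hz hd x (n + 1)).mono (hG.anti (by lia))) _
  simp only [truncatedExpAd_apply, sum_range_succ' _ (N + 1), sum_range_succ' _ N]
  simpa [add_assoc, add_comm, add_left_comm] using
    higher_terms.add (SModEq.refl (⁅z, x⁆ + ⁅d, x⁆ + x))

end IsLieFiltration

lemma IsProfiniteLieFiltration.exists_sum_sModEq {G : ℕ → Submodule K S}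
    (hG : IsProfiniteLieFiltration G) {u : ℕ → S} (hu : ∀ n, u n ∈ G n) :
    ∃ a, ∀ N, ∑ n ∈ range N, u n ≡ a [SMOD G N] := by
  obtain ⟨a, ha⟩ := hG.exists_limit (fun N ↦ ∑ n ∈ range (N + 1), u n) fun N ↦ by
    rw [SModEq.sub_mem, sum_range_succ _ (N + 1), add_sub_cancel_left]
    exact hu (N + 1)
  refine ⟨a, fun N ↦ ?_⟩
  cases N with
  | zero => exact hG.zero ▸ SModEq.top
  | succ N => exact (ha N).symm

section Conjugation

variable {G : ℕ → Submodule K S} [CharZero K] [FiniteDimensional K L] [IsSemisimple K L]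

lemma IsProfiniteLieFiltration.exists_correction (hG : IsProfiniteLieFiltration G)
    (s t : L →ₗ⁅K⁆ S) (hst : ∀ p, s p ≡ t p [SMOD G 1]) {k : ℕ} {z : S} (hz : z ∈ G 1)
    (h : ∀ p, truncatedExpAd K (k + 1) z (s p) ≡ t p [SMOD G (k + 1)]) :
    ∃ d ∈ G (k + 1), ∀ p, truncatedExpAd K (k + 2) (z + d) (s p) ≡ t p [SMOD G (k + 2)] := by
  let _ : LieRingModule L S := LieRingModule.compLieHom S t
  have _ : LieModule K L S := LieModule.compLieHom S t
  have lie_def (p : L) (x : S) : ⁅p, x⁆ = ⁅t p, x⁆ := rfl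
  let A (i : ℕ) : LieSubmodule K L S :=
    { G i with
      lie_mem := fun {p x} hx ↦ by
        have := hG.lie_mem (hG.mem_zero (t p)) hx
        rwa [zero_add] at this }
  have : FiniteDimensional K (S ⧸ A (k + 2)) := hG.finiteDimensional_quotient (k + 2)
  let c : L →ₗ[K] S := truncatedExpAd K (k + 2) z ∘ₗ (s : L →ₗ[K] S) - (t : L →ₗ[K] S)
  have truncatedExpAd_eq (p : L) : truncatedExpAd K (k + 2) z (s p) = t p + c p := by simp [c]
  have c_mem (p : L) : c p ∈ G (k + 1) := SModEq.sub_mem.mp <|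
    (hG.truncatedExpAd_sModEq_of_le hz (k + 1).le_succ (s p)).trans (h p)
  have c_cocycle (p q : L) : c ⁅p, q⁆ ≡ ⁅p, c q⁆ - ⁅q, c p⁆ [SMOD G (k + 2)] := by
    have hom := hG.truncatedExpAd_lie_sModEq hz (k + 2) (s p) (s q)
    rw [← LieHom.map_lie, truncatedExpAd_eq, truncatedExpAd_eq, truncatedExpAd_eq,
      LieHom.map_lie] at hom
    have c_lie_c : ⁅c p, c q⁆ ∈ G (k + 2) := hG.anti (by lia) (hG.lie_mem (c_mem p) (c_mem q))
    rw [SModEq.sub_mem] at hom ⊢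
    convert add_mem hom c_lie_c using 1
    rw [lie_def, lie_def, ← lie_skew (t q) (c p)]
    simp only [add_lie, lie_add]
    abel
  obtain ⟨d, hd, hcd⟩ := exists_lie_sModEq_of_cocycle (A (k + 1)) (A (k + 2)) c c_mem c_cocycle
  refine ⟨d, hd, fun p ↦ ?_⟩
  have lie_d : ⁅d, s p⁆ ≡ -c p [SMOD G (k + 2)] := by
    have skew := (hcd p).symm.neg
    rw [lie_def, lie_skew] at skew
    exact (hG.lie_sModEq_lie hd (hst p)).trans skew
  calc truncatedExpAd K (k + 2) (z + d) (s p)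
      ≡ truncatedExpAd K (k + 2) z (s p) + ⁅d, s p⁆ [SMOD G (k + 2)] :=
        hG.truncatedExpAd_add_sModEq_add_lie hz hd (s p) k
    _ ≡ t p + c p + -c p [SMOD G (k + 2)] := by
        rw [truncatedExpAd_eq]
        exact (SModEq.refl _).add lie_d
    _ = t p := add_neg_cancel_right _ _

theorem IsProfiniteLieFiltration.exists_truncatedExpAd_sModEq (hG : IsProfiniteLieFiltration G)
    (s t : L →ₗ⁅K⁆ S) (hst : ∀ p, s p ≡ t p [SMOD G 1]) :
    ∃ z ∈ G 1, ∀ N p, truncatedExpAd K N z (s p) ≡ t p [SMOD G N] := by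
  have exists_next (k : ℕ) (z : S) : (z ∈ G 1 ∧
      ∀ p, truncatedExpAd K (k + 1) z (s p) ≡ t p [SMOD G (k + 1)]) →
      ∃ d ∈ G (k + 1), ∀ p, truncatedExpAd K (k + 2) (z + d) (s p) ≡ t p [SMOD G (k + 2)] :=
    fun h ↦ hG.exists_correction s t hst h.1 h.2
  choose! d d_mem hd using exists_next
  let u : ℕ → S := Nat.rec 0 fun k z ↦ z + d k z
  have u_spec (k : ℕ) : u k ∈ G 1 ∧
      ∀ p, truncatedExpAd K (k + 1) (u k) (s p) ≡ t p [SMOD G (k + 1)] := by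
    induction k with
    | zero => exact ⟨zero_mem _, fun p ↦ by simpa [truncatedExpAd_apply] using hst p⟩
    | succ k ih =>
      exact ⟨add_mem ih.1 (hG.anti (Nat.le_add_left 1 k) (d_mem k _ ih)), hd k _ ih⟩
  obtain ⟨z, hz⟩ := hG.exists_limit u fun k ↦ SModEq.sub_mem.mpr <| by
    simpa [u] using d_mem k (u k) (u_spec k)
  refine ⟨z, by simpa [u] using SModEq.sub_mem.mp (hz 0), fun N p ↦ ?_⟩
  cases N with
  | zero => exact hG.zero ▸ SModEq.top
  | succ N =>
    have perturb := hG.truncatedExpAd_add_sModEq (u_spec N).1 (SModEq.sub_mem.mp (hz N)) (s p)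
      (N + 1)
    rw [add_sub_cancel] at perturb
    exact perturb.trans ((u_spec N).2 p)

end Conjugation

end LieFiltration

section SemidirectSum

open LieAlgebra SemiDirectSum Finset

variable {K L S : Type*} [Field K] [LieRing L] [LieAlgebra K L] [LieRing S] [LieAlgebra K S]
  (ψ : L →ₗ⁅K⁆ LieDerivation K S S)

/-- The filtration of `S ⋊⁅ψ⁆ L` induced by a filtration of `S`, with `L` placed in degree `0`. -/
def semidirectFiltration (F : ℕ → Submodule K S) (k : ℕ) : Submodule K (S ⋊⁅ψ⁆ L) where
  carrier := {s | s.left ∈ F k ∧ (k ≠ 0 → s.right = 0)}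
  add_mem' hs ht := ⟨add_mem hs.1 ht.1, fun hk ↦ by simp [hs.2 hk, ht.2 hk]⟩
  zero_mem' := ⟨zero_mem _, fun _ ↦ rfl⟩
  smul_mem' c _ hs := ⟨Submodule.smul_mem _ c hs.1, fun hk ↦ by simp [hs.2 hk]⟩

variable {ψ} {F : ℕ → Submodule K S}

lemma sModEq_semidirectFiltration {k : ℕ} {s t : S ⋊⁅ψ⁆ L} :
    s ≡ t [SMOD semidirectFiltration ψ F k] ↔
      s.left ≡ t.left [SMOD F k] ∧ (k ≠ 0 → s.right = t.right) := by
  simp only [SModEq.sub_mem, ← sub_eq_zero (a := s.right)]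
  rfl

lemma IsLieFiltration.semidirect (hF : IsLieFiltration F)
    (hψ : ∀ p k x, x ∈ F k → ψ p x ∈ F k) : IsLieFiltration (semidirectFiltration ψ F) where
  zero := eq_top_iff.mpr fun s _ ↦ ⟨hF.mem_zero s.left, fun h ↦ absurd rfl h⟩
  anti i j h s hs := ⟨hF.anti h hs.1, fun hi ↦ hs.2 (by lia)⟩
  lie_mem := by
    rintro i j ⟨x, p⟩ ⟨y, q⟩ ⟨hx, hp⟩ ⟨hy, hq⟩
    dsimp only at hx hp hy hq
    refine ⟨?_, fun h ↦ ?_⟩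
    · change ⁅x, y⁆ + ψ p y - ψ q x ∈ F (i + j)
      refine sub_mem (add_mem (hF.lie_mem hx hy) ?_) ?_
      · rcases eq_or_ne i 0 with rfl | hi
        · simpa using hψ p j y hy
        · simp [hp hi]
      · rcases eq_or_ne j 0 with rfl | hj
        · simpa using hψ q i x hx
        · simp [hq hj]
    · change ⁅p, q⁆ = 0
      rcases eq_or_ne i 0 with rfl | hi
      · rw [hq (by lia), lie_zero]
      · rw [hp hi, zero_lie]

lemma IsProfiniteLieFiltration.semidirect [FiniteDimensional K L]
    (hF : IsProfiniteLieFiltration F) (hψ : ∀ p k x, x ∈ F k → ψ p x ∈ F k) :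
    IsProfiniteLieFiltration (semidirectFiltration ψ F) where
  toIsLieFiltration := hF.toIsLieFiltration.semidirect hψ
  finiteDimensional_quotient k := by
    let θ : S ⋊⁅ψ⁆ L →ₗ[K] (S ⧸ F k) × L :=
      ((F k).mkQ ∘ₗ projl ψ).prod (projr ψ : S ⋊⁅ψ⁆ L →ₗ[K] L)
    have ker_le : LinearMap.ker θ ≤ semidirectFiltration ψ F k := fun s hs ↦ by
      obtain ⟨hl, hr⟩ := Prod.mk.inj (LinearMap.mem_ker.mp hs)
      exact ⟨(Submodule.Quotient.mk_eq_zero _).mp hl, fun _ ↦ hr⟩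
    have := hF.finiteDimensional_quotient k
    have : FiniteDimensional K ((S ⋊⁅ψ⁆ L) ⧸ LinearMap.ker θ) :=
      Module.Finite.equiv θ.quotKerEquivRange.symm
    exact Module.Finite.of_surjective _ (Submodule.factor_surjective ker_le)
  exists_limit u hu := by
    simp only [sModEq_semidirectFiltration] at hu ⊢
    obtain ⟨z, hz⟩ := hF.exists_limit (fun k ↦ (u k).left) fun k ↦ (hu k).1
    have right_const (k : ℕ) : (u k).right = (u 0).right := by
      induction k with
      | zero => rfl
      | succ k ih => exact ((hu k).2 k.succ_ne_zero).trans ih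
    exact ⟨⟨z, (u 0).right⟩, fun k ↦ ⟨hz k, fun _ ↦ (right_const k).symm⟩⟩

lemma ad_pow_succ_semidirect (ξ x : S) (p : L) (n : ℕ) :
    (ad K (S ⋊⁅ψ⁆ L) ⟨ξ, 0⟩ ^ (n + 1)) ⟨x, p⟩ =
      ⟨(ad K S ξ ^ (n + 1)) x - (ad K S ξ ^ n) (ψ p ξ), 0⟩ := by
  induction n with
  | zero => ext <;> simp
  | succ n ih =>
    rw [ad_pow_succ_apply, ih, ad_pow_succ_apply ξ x (n + 1), ad_pow_succ_apply ξ (ψ p ξ)]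
    ext <;> simp

lemma left_truncatedExpAd_succ (ξ x : S) (p : L) (N : ℕ) :
    (truncatedExpAd K (N + 1) (⟨ξ, 0⟩ : S ⋊⁅ψ⁆ L) ⟨x, p⟩).left =
      truncatedExpAd K (N + 1) ξ x -
        ∑ n ∈ range N, ((n + 1)! : K)⁻¹ • (ad K S ξ ^ n) (ψ p ξ) := by
  change projl ψ _ = _
  simp only [truncatedExpAd_apply, sum_range_succ', ad_pow_succ_semidirect, map_add, map_sum,
    map_smul, projl_mk, smul_sub, sum_sub_distrib, pow_zero, Module.End.one_apply]
  abel

variable (ψ) in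
/-- A linear map `ρ : L → S` is a Maurer–Cartan element for the action `ψ` of `L` on `S` if its
graph map `p ↦ (ρ p, p)` to the semidirect sum preserves brackets. -/
def IsMaurerCartan (ρ : L →ₗ[K] S) : Prop :=
  ∀ p q, ρ ⁅p, q⁆ = ⁅ρ p, ρ q⁆ + ψ p (ρ q) - ψ q (ρ p)

/-- The graph map `p ↦ (ρ p, p)`, a section of the projection `S ⋊⁅ψ⁆ L → L`. -/
def IsMaurerCartan.toSemiDirectSum {ρ : L →ₗ[K] S} (hρ : IsMaurerCartan ψ ρ) :
    L →ₗ⁅K⁆ S ⋊⁅ψ⁆ L where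
  toFun p := ⟨ρ p, p⟩
  map_add' p q := by simp
  map_smul' c p := by simp
  map_lie' {p q} := by simp [hρ p q]

theorem IsProfiniteLieFiltration.exists_gauge_sModEq [CharZero K] [FiniteDimensional K L]
    [IsSemisimple K L] (hF : IsProfiniteLieFiltration F) (hψ : ∀ p k x, x ∈ F k → ψ p x ∈ F k)
    {σ τ : L →ₗ[K] S} (hσ : IsMaurerCartan ψ σ) (hτ : IsMaurerCartan ψ τ)
    (hστ : ∀ p, σ p ≡ τ p [SMOD F 1]) :
    ∃ ξ ∈ F 1, ∀ N p, truncatedExpAd K N ξ (σ p) -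
      ∑ n ∈ range N, ((n + 1)! : K)⁻¹ • (ad K S ξ ^ n) (ψ p ξ) ≡ τ p [SMOD F N] := by
  obtain ⟨⟨ξ, p₀⟩, hξ, conj⟩ := (hF.semidirect hψ).exists_truncatedExpAd_sModEq
    hσ.toSemiDirectSum hτ.toSemiDirectSum fun p ↦
      sModEq_semidirectFiltration.mpr ⟨hστ p, fun _ ↦ rfl⟩
  obtain rfl : p₀ = 0 := hξ.2 one_ne_zero
  refine ⟨ξ, hξ.1, fun N p ↦ ?_⟩
  have left_conj := (sModEq_semidirectFiltration.mp (conj (N + 1) p)).1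
  have truncation := hF.truncatedExpAd_sModEq_of_le hξ.1 N.le_succ (σ p)
  change (truncatedExpAd K (N + 1) (⟨ξ, 0⟩ : S ⋊⁅ψ⁆ L) ⟨σ p, p⟩).left ≡ τ p [SMOD F (N + 1)]
    at left_conj
  rw [left_truncatedExpAd_succ] at left_conj
  exact (truncation.symm.sub SModEq.rfl).trans (left_conj.mono (hF.anti N.le_succ))

end SemidirectSum

section PowerSeries

open MvPowerSeries

variable {ι K : Type*} [Field K] [CharZero K]

-- Euler's identity: `∑ i, m i = degree m`, so the weights `m i / degree m` distribute each
-- monomial of positive degree over the variables.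
lemma exists_eq_sum_X_mul_of_lt_order [Fintype ι] {k : ℕ} {f : MvPowerSeries ι K}
    (hf : k < f.order) :
    ∃ g : ι → MvPowerSeries ι K, (∀ i, k ≤ (g i).order) ∧ f = ∑ i, X i * g i := by
  let g (i : ι) : MvPowerSeries ι K := fun n ↦
    (n i + 1 : K) / (n.degree + 1) * coeff (n + Finsupp.single i 1) f
  have coeff_g (i n) : coeff n (g i) =
    (n i + 1 : K) / (n.degree + 1) * coeff (n + Finsupp.single i 1) f := rfl
  have coeff_X_mul_g (i : ι) (m) : coeff m (X i * g i) = (m i : K) / m.degree * coeff m f := by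
    classical
    by_cases hm : Finsupp.single i 1 ≤ m
    · obtain ⟨n, rfl⟩ := exists_add_of_le hm
      rw [X, coeff_add_monomial_mul, coeff_g]
      simp [add_comm]
    · rw [X, coeff_monomial_mul, if_neg hm]
      rw [Finsupp.single_le_iff, not_le, Nat.lt_one_iff] at hm
      simp [hm]
  refine ⟨g, fun i ↦ nat_le_order fun n hn ↦ ?_, ?_⟩
  · have degree_le : (n + Finsupp.single i 1).degree ≤ k := by
      rw [map_add, Finsupp.degree_single]
      exact hn
    rw [coeff_g, coeff_of_lt_order ((Nat.cast_le.mpr degree_le).trans_lt hf), mul_zero]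
  · ext m
    rw [map_sum, Finset.sum_congr rfl fun i _ ↦ coeff_X_mul_g i m, ← Finset.sum_mul,
      ← Finset.sum_div, ← Nat.cast_sum, ← Finsupp.degree_eq_sum]
    rcases eq_or_ne m 0 with rfl | hm
    · simp [coeff_of_lt_order (f := f) (d := 0) (by simpa using bot_lt_of_lt hf)]
    · have degree_ne : (m.degree : K) ≠ 0 := mod_cast mt (Finsupp.degree_eq_zero_iff m).mp hm
      rw [div_self degree_ne, one_mul]

lemma le_order_derivation_apply [Finite ι]
    (D : Derivation K (MvPowerSeries ι K) (MvPowerSeries ι K))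
    (hD : ∀ i, constantCoeff (D (X i)) = 0) {k : ℕ} {f : MvPowerSeries ι K}
    (hf : k ≤ f.order) : k ≤ (D f).order := by
  have := Fintype.ofFinite ι
  induction k generalizing f with
  | zero => simp
  | succ k ih =>
    have le_order_mul_of {a b : MvPowerSeries ι K} (ha : constantCoeff a = 0)
        (hb : k ≤ b.order) : (k + 1 : ℕ) ≤ (a * b).order := by
      rw [Nat.cast_succ, add_comm]
      exact (add_le_add (one_le_order_iff_constCoeff_eq_zero.mpr ha) hb).trans le_order_mul
    obtain ⟨g, hg, rfl⟩ := exists_eq_sum_X_mul_of_lt_order <|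
      (Nat.cast_lt.mpr k.lt_succ_self).trans_le hf
    refine nat_le_order fun m hm ↦ ?_
    rw [map_sum, map_sum]
    refine Finset.sum_eq_zero fun i _ ↦ coeff_of_lt_order ((Nat.cast_lt.mpr hm).trans_le ?_)
    rw [Derivation.leibniz, smul_eq_mul, smul_eq_mul, mul_comm (g i)]
    exact (le_min (le_order_mul_of (constantCoeff_X i) (ih (hg i)))
      (le_order_mul_of (hD i) (hg i))).trans min_order_le_add

end PowerSeries

namespace JetAlgebra

variable {ι : Type*} {𝔨 : Type*} [LieRing 𝔨] [LieAlgebra ℝ 𝔨]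

section Coefficients

lemma coeffAt_tmul (m : ι →₀ ℕ) (f : FormalSeries ι) (X : 𝔨) :
    coeffAt m (f ⊗ₜ[ℝ] X) = MvPowerSeries.coeff m f • X := by
  simp [coeffAt]

lemma coeffAt_lie [DecidableEq ι] (m : ι →₀ ℕ) (x y : Jet ι 𝔨) :
    coeffAt m ⁅x, y⁆ =
      ∑ p ∈ Finset.HasAntidiagonal.antidiagonal m, ⁅coeffAt p.1 x, coeffAt p.2 y⁆ := by
  induction x using TensorProduct.induction_on with
  | zero => rw [zero_lie (L := Jet ι 𝔨) y]; simp
  | add x x' hx hx' =>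
    rw [add_lie (L := Jet ι 𝔨) x x' y]
    simp only [map_add, hx, hx', add_lie, Finset.sum_add_distrib]
  | tmul f X =>
    induction y using TensorProduct.induction_on with
    | zero => rw [lie_zero (L := Jet ι 𝔨)]; simp
    | add y y' hy hy' =>
      rw [lie_add (L := Jet ι 𝔨)]
      simp only [map_add, hy, hy', lie_add, Finset.sum_add_distrib]
    | tmul g Y =>
      simp only [LieAlgebra.ExtendScalars.bracket_tmul, coeffAt_tmul, MvPowerSeries.coeff_mul,
        Finset.sum_smul, smul_lie, lie_smul, smul_smul, mul_comm]

lemma coeff_basis_repr {κ : Type*} (b : Module.Basis κ ℝ 𝔨) (m : ι →₀ ℕ) (x : Jet ι 𝔨) (i : κ) :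
    MvPowerSeries.coeff m ((Algebra.TensorProduct.basis (FormalSeries ι) b).repr x i) =
      b.repr (coeffAt m x) i := by
  induction x using TensorProduct.induction_on with
  | zero => simp
  | add x y hx hy => simp [hx, hy]
  | tmul f X => simp [coeffAt_tmul, MvPowerSeries.algebraMap_apply, mul_comm]

lemma exists_coeffAt_eq [FiniteDimensional ℝ 𝔨] (c : (ι →₀ ℕ) → 𝔨) :
    ∃ x : Jet ι 𝔨, ∀ m, coeffAt m x = c m := by
  let b := Module.finBasis ℝ 𝔨
  let B := Algebra.TensorProduct.basis (FormalSeries ι) b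
  let coord (i) : FormalSeries ι := fun m ↦ b.repr (c m) i
  refine ⟨B.equivFun.symm coord, fun m ↦ b.ext_elem fun i ↦ ?_⟩
  rw [← coeff_basis_repr, ← Module.Basis.equivFun_apply,
    LinearEquiv.apply_symm_apply B.equivFun coord]
  rfl

lemma ev₀_const (X : 𝔨) : ev₀ (const X : Jet ι 𝔨) = X := by
  simp [ev₀, const, coeffAt_tmul]

lemma const_lie (X Y : 𝔨) : (const ⁅X, Y⁆ : Jet ι 𝔨) = ⁅(const X : Jet ι 𝔨), const Y⁆ := by
  simp [const]

lemma ev₀_lie (x y : Jet ι 𝔨) : ev₀ ⁅x, y⁆ = ⁅ev₀ x, ev₀ y⁆ := by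
  classical
  simp [ev₀, coeffAt_lie]

end Coefficients

section LieDerivative

lemma constantCoeff_vectorField_apply (v : VectorFields ι) (f : FormalSeries ι) :
    MvPowerSeries.constantCoeff (v.1 f) = 0 := by
  have apply_sub_const := v.2 (f - algebraMap ℝ _ (MvPowerSeries.constantCoeff f)) <| by
    simp [MvPowerSeries.algebraMap_apply]
  rwa [map_sub, Derivation.map_algebraMap, sub_zero] at apply_sub_const

lemma lieDeriv_tmul (v : VectorFields ι) (f : FormalSeries ι) (X : 𝔨) :
    lieDeriv v (f ⊗ₜ[ℝ] X) = v.1 f ⊗ₜ[ℝ] X := by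
  simp [lieDeriv]

lemma lieDeriv_const (v : VectorFields ι) (X : 𝔨) : lieDeriv v (const X) = 0 := by
  simp [const, lieDeriv_tmul]

lemma ev₀_lieDeriv (v : VectorFields ι) (x : Jet ι 𝔨) : ev₀ (lieDeriv v x) = 0 := by
  induction x using TensorProduct.induction_on with
  | zero => simp
  | add x y hx hy => rw [map_add, map_add, hx, hy, add_zero]
  | tmul f X =>
    rw [lieDeriv_tmul, ev₀, coeffAt_tmul, MvPowerSeries.coeff_zero_eq_constantCoeff_apply,
      constantCoeff_vectorField_apply, zero_smul]

end LieDerivative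

section OrderFiltration

/-- The jets that vanish to order `k` at the origin; for finite `ι` this is `I ^ k ⊗ 𝔨`. -/
def orderGE (ι 𝔨 : Type*) [LieRing 𝔨] [LieAlgebra ℝ 𝔨] (k : ℕ) : Submodule ℝ (Jet ι 𝔨) where
  carrier := {x | ∀ m : ι →₀ ℕ, m.degree < k → coeffAt m x = 0}
  add_mem' hx hy m hm := by simp [hx m hm, hy m hm]
  zero_mem' m _ := by simp
  smul_mem' c x hx m hm := by simp [hx m hm]

lemma sModEq_orderGE {k : ℕ} {x y : Jet ι 𝔨} :
    x ≡ y [SMOD orderGE ι 𝔨 k] ↔ ∀ m : ι →₀ ℕ, m.degree < k → coeffAt m x = coeffAt m y := by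
  simp only [SModEq.sub_mem, ← sub_eq_zero (a := coeffAt _ x), ← map_sub]
  rfl

lemma sModEq_orderGE_one {x y : Jet ι 𝔨} :
    x ≡ y [SMOD orderGE ι 𝔨 1] ↔ ev₀ x = ev₀ y := by
  simp [sModEq_orderGE, Finsupp.degree_eq_zero_iff, ev₀]

lemma lieDeriv_mem_orderGE [Finite ι] [FiniteDimensional ℝ 𝔨] (v : VectorFields ι) {k : ℕ}
    {x : Jet ι 𝔨} (hx : x ∈ orderGE ι 𝔨 k) : lieDeriv v x ∈ orderGE ι 𝔨 k := by
  let b := Module.finBasis ℝ 𝔨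
  let B := Algebra.TensorProduct.basis (FormalSeries ι) b
  have order_repr (i) : k ≤ (B.repr x i).order := MvPowerSeries.nat_le_order fun m hm ↦ by
    rw [coeff_basis_repr, hx m hm, map_zero, Finsupp.zero_apply]
  have x_eq : x = ∑ i, B.repr x i ⊗ₜ[ℝ] b i := by
    conv_lhs => rw [← B.sum_repr x]
    simp [B, TensorProduct.smul_tmul']
  intro m hm
  rw [x_eq, map_sum, map_sum]
  refine Finset.sum_eq_zero fun i _ ↦ ?_
  rw [lieDeriv_tmul, coeffAt_tmul, MvPowerSeries.coeff_of_lt_order, zero_smul]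
  exact (Nat.cast_lt.mpr hm).trans_le <| le_order_derivation_apply _
    (fun j ↦ constantCoeff_vectorField_apply v _) (order_repr i)

lemma isLieFiltration_orderGE : IsLieFiltration (orderGE ι 𝔨) where
  zero := eq_top_iff.mpr fun _ _ m hm ↦ absurd hm m.degree.not_lt_zero
  anti _ _ h _ hx m hm := hx m (hm.trans_le h)
  lie_mem {i j x y} hx hy m hm := by
    classical
    rw [coeffAt_lie]
    refine Finset.sum_eq_zero fun p hp ↦ ?_
    rw [Finset.HasAntidiagonal.mem_antidiagonal] at hp
    rw [← hp, map_add] at hm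
    by_cases h : p.1.degree < i
    · rw [hx _ h, zero_lie]
    · rw [hy _ (by lia), lie_zero]

lemma isProfiniteLieFiltration_orderGE [Finite ι] [FiniteDimensional ℝ 𝔨] :
    IsProfiniteLieFiltration (orderGE ι 𝔨) where
  toIsLieFiltration := isLieFiltration_orderGE
  finiteDimensional_quotient k := by
    have : Finite {m : ι →₀ ℕ // m.degree ≤ k} := Finsupp.finite_of_degree_le k
    let coeffs : Jet ι 𝔨 →ₗ[ℝ] {m : ι →₀ ℕ // m.degree ≤ k} → 𝔨 :=
      LinearMap.pi fun m ↦ coeffAt m.1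
    have ker_le : LinearMap.ker coeffs ≤ orderGE ι 𝔨 k := fun x hx m hm ↦
      congrFun (LinearMap.mem_ker.mp hx) ⟨m, hm.le⟩
    have : FiniteDimensional ℝ (Jet ι 𝔨 ⧸ LinearMap.ker coeffs) :=
      Module.Finite.equiv coeffs.quotKerEquivRange.symm
    exact Module.Finite.of_surjective _ (Submodule.factor_surjective ker_le)
  exists_limit u hu := by
    simp only [sModEq_orderGE] at hu ⊢
    have coeffAt_stable (m : ι →₀ ℕ) (k : ℕ) (hk : m.degree ≤ k) :
        coeffAt m (u k) = coeffAt m (u m.degree) := by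
      induction k, hk using Nat.le_induction with
      | base => rfl
      | succ k hk ih => rw [hu k m (by lia), ih]
    obtain ⟨z, hz⟩ := exists_coeffAt_eq fun m ↦ coeffAt m (u m.degree)
    exact ⟨z, fun k m hm ↦ (hz m).trans (coeffAt_stable m k (by lia)).symm⟩

lemma hasSum_of_sModEq_orderGE {u : ℕ → Jet ι 𝔨} {a : Jet ι 𝔨}
    (h : ∀ N, ∑ n ∈ Finset.range N, u n ≡ a [SMOD orderGE ι 𝔨 N]) : HasSum u a := by
  simp only [sModEq_orderGE] at h
  have coeffAt_term (m : ι →₀ ℕ) (n : ℕ) (hn : m.degree < n) : coeffAt m (u n) = 0 := by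
    have := (h (n + 1) m (by lia)).trans (h n m hn).symm
    rwa [Finset.sum_range_succ, map_add, add_eq_left] at this
  rw [HasSum, SummationFilter.unconditional_filter, jetTopology, nhds_iInf,
    Filter.tendsto_iInf]
  intro m
  let _ : TopologicalSpace 𝔨 := moduleTopology ℝ 𝔨
  rw [nhds_induced, Filter.tendsto_comap_iff]
  refine tendsto_const_nhds.congr' ?_
  filter_upwards [Filter.eventually_ge_atTop (Finset.range (m.degree + 1))] with s hs
  rw [Function.comp_apply, ← h (m.degree + 1) m m.degree.lt_succ_self, map_sum, map_sum]
  exact Finset.sum_subset hs fun n _ hn ↦ coeffAt_term m n (by simpa using hn)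

end OrderFiltration

end JetAlgebra

namespace JetAlgebra

variable {ι 𝔨 𝔭 : Type*} [LieRing 𝔨] [LieAlgebra ℝ 𝔨] [LieRing 𝔭] [LieAlgebra ℝ 𝔭]

section Gauge

variable {v : 𝔭 →ₗ[ℝ] VectorFields ι} (hv : ∀ p q : 𝔭, v ⁅p, q⁆ = ⁅v q, v p⁆)

/-- The action `p ↦ -ℒ_{v(p)}` of `𝔭` on `𝔤` by derivations; the sign compensates for `v` being
an antihomomorphism. -/
noncomputable def lieDerivAction : 𝔭 →ₗ⁅ℝ⁆ LieDerivation ℝ (Jet ι 𝔨) (Jet ι 𝔨) :=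
  (Lie.Derivation.ofDerivation 𝔨).comp
    { toFun p := -(v p).1
      map_add' p q := by simp [add_comm]
      map_smul' c p := by simp
      map_lie' {p q} := by
        rw [hv, ← lie_skew]
        simp }

lemma lieDerivAction_apply (p : 𝔭) (x : Jet ι 𝔨) :
    lieDerivAction hv p x = -lieDeriv (v p) x := by
  simp [lieDerivAction, lieDeriv]

lemma MaurerCartan.isMaurerCartan {σ : 𝔭 →ₗ[ℝ] Jet ι 𝔨} (hσ : MaurerCartan v σ) :
    IsMaurerCartan (lieDerivAction hv) σ := fun p q ↦ by
  rw [lieDerivAction_apply, lieDerivAction_apply, ← sub_eq_zero, ← neg_eq_zero, ← hσ p q]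
  abel

lemma ad_formalSeries_pow_apply (ξ x : Jet ι 𝔨) (n : ℕ) :
    (LieAlgebra.ad (FormalSeries ι) (Jet ι 𝔨) ξ ^ n) x =
      (LieAlgebra.ad ℝ (Jet ι 𝔨) ξ ^ n) x := by
  simp only [Module.End.pow_apply]
  rfl

include hv in
theorem gaugeEquivalent_of_ev₀_eq [Finite ι] [FiniteDimensional ℝ 𝔨] [FiniteDimensional ℝ 𝔭]
    [LieAlgebra.IsSemisimple ℝ 𝔭] {σ τ : 𝔭 →ₗ[ℝ] Jet ι 𝔨} (hσ : MaurerCartan v σ)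
    (hτ : MaurerCartan v τ) (hστ : ∀ p, ev₀ (σ p) = ev₀ (τ p)) : GaugeEquivalent v σ τ := by
  refine ⟨hσ, hτ, ?_⟩
  obtain ⟨ξ, hξ, gauge⟩ := isProfiniteLieFiltration_orderGE.exists_gauge_sModEq
    (fun p _ x hx ↦ lieDerivAction_apply hv p x ▸ neg_mem (lieDeriv_mem_orderGE (v p) hx))
    (hσ.isMaurerCartan hv) (hτ.isMaurerCartan hv) fun p ↦ sModEq_orderGE_one.mpr (hστ p)
  refine ⟨ξ, fun p ↦ ?_⟩
  obtain ⟨a, ha⟩ := isProfiniteLieFiltration_orderGE.exists_sum_sModEq fun n ↦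
    Submodule.smul_mem _ (n ! : ℝ)⁻¹ (isLieFiltration_orderGE.ad_pow_mem hξ (σ p) n)
  refine ⟨a, τ p - a, hasSum_of_sModEq_orderGE fun N ↦ ?_, hasSum_of_sModEq_orderGE fun N ↦ ?_,
    (add_sub_cancel a (τ p)).symm⟩
  · simpa only [ad_formalSeries_pow_apply] using ha N
  · have difference := (gauge N p).sub (ha N)
    rw [truncatedExpAd_apply, sub_sub_cancel_left] at difference
    simpa only [ad_formalSeries_pow_apply, lieDerivAction_apply, Finset.sum_neg_distrib]
      using difference

end Gauge

lemma maurerCartan_const (v : 𝔭 →ₗ[ℝ] VectorFields ι) (f : 𝔭 →ₗ⁅ℝ⁆ 𝔨) :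
    MaurerCartan v (const ∘ₗ (f : 𝔭 →ₗ[ℝ] 𝔨)) := fun p q ↦ by
  simp only [LinearMap.comp_apply, lieDeriv_const, LieHom.coe_toLinearMap, LieHom.map_lie,
    const_lie, neg_zero, add_zero, zero_sub]
  exact neg_add_cancel _

lemma MaurerCartan.ev₀_lie {v : 𝔭 →ₗ[ℝ] VectorFields ι} {σ : 𝔭 →ₗ[ℝ] Jet ι 𝔨}
    (hσ : MaurerCartan v σ) (p q : 𝔭) : ev₀ (σ ⁅p, q⁆) = ⁅ev₀ (σ p), ev₀ (σ q)⁆ := by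
  have ev₀_eq := congrArg ev₀ (hσ p q)
  simp only [map_add, map_sub, map_neg, ev₀_lieDeriv, JetAlgebra.ev₀_lie, map_zero, neg_zero,
    zero_add, zero_sub, neg_add_eq_zero] at ev₀_eq
  exact ev₀_eq

section Compact

variable {L M : Type*} [LieRing L] [LieAlgebra ℝ L] [LieRing M] [LieAlgebra ℝ M]

lemma IsCompactLieAlgebra.of_injective (hM : IsCompactLieAlgebra M) (f : L →ₗ⁅ℝ⁆ M)
    (hf : Function.Injective f) : IsCompactLieAlgebra L := by
  obtain ⟨B, symm, pos, skew⟩ := hM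
  refine ⟨B.comp f f, ⟨fun x y ↦ symm.eq _ _⟩, fun x hx ↦ ?_, fun x y z ↦ ?_⟩
  · exact pos _ ((map_ne_zero_iff f hf).mpr hx)
  · simpa using skew (f x) (f y) (f z)

lemma IsCompactLieAlgebra.lieHom_eq_zero [LieAlgebra.IsSemisimple ℝ L]
    (hM : IsCompactLieAlgebra M) (hL : ∀ J : LieIdeal ℝ L, IsCompactLieAlgebra J → J = ⊥)
    (f : L →ₗ⁅ℝ⁆ M) : f = 0 := by
  obtain ⟨J, hJ⟩ := exists_isCompl f.ker
  have injective_on_J : Function.Injective (f.comp J.incl) := by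
    refine (injective_iff_map_eq_zero _).mpr fun x hx ↦ Subtype.ext ?_
    have x_mem : (x : L) ∈ f.ker ⊓ J := ⟨hx, x.2⟩
    simpa [hJ.inf_eq_bot] using x_mem
  have J_eq_bot : J = ⊥ := hL J (hM.of_injective _ injective_on_J)
  have ker_eq_top : f.ker = ⊤ := by simpa [J_eq_bot] using hJ.sup_eq_top
  ext x
  exact f.mem_ker.mp (ker_eq_top ▸ trivial)

end Compact

end JetAlgebra

theorem mainTheorem7_general {ι : Type*} [Finite ι]
    {𝔨 : Type*} [LieRing 𝔨] [LieAlgebra ℝ 𝔨] [FiniteDimensional ℝ 𝔨]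
    {𝔭 : Type*} [LieRing 𝔭] [LieAlgebra ℝ 𝔭] [FiniteDimensional ℝ 𝔭]
    [LieAlgebra.IsSemisimple ℝ 𝔭]
    (v : 𝔭 →ₗ[ℝ] JetAlgebra.VectorFields ι) (hv : ∀ p q : 𝔭, v ⁅p, q⁆ = ⁅v q, v p⁆)
    (σ : 𝔭 →ₗ[ℝ] JetAlgebra.Jet ι 𝔨) (hσ : JetAlgebra.MaurerCartan v σ) :
    (∃ σ₀ : 𝔭 →ₗ⁅ℝ⁆ 𝔨, (σ₀ : 𝔭 →ₗ[ℝ] 𝔨) = JetAlgebra.ev₀ ∘ₗ σ ∧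
      JetAlgebra.GaugeEquivalent v σ (JetAlgebra.const ∘ₗ (σ₀ : 𝔭 →ₗ[ℝ] 𝔨))) ∧
    (JetAlgebra.IsCompactLieAlgebra 𝔨 →
      (∀ J : LieIdeal ℝ 𝔭, JetAlgebra.IsCompactLieAlgebra J → J = ⊥) →
      JetAlgebra.GaugeEquivalent v σ 0) := by
  let σ₀ : 𝔭 →ₗ⁅ℝ⁆ 𝔨 := { JetAlgebra.ev₀ ∘ₗ σ with map_lie' := hσ.ev₀_lie _ _ }
  have gauge_σ₀ : JetAlgebra.GaugeEquivalent v σ (JetAlgebra.const ∘ₗ (σ₀ : 𝔭 →ₗ[ℝ] 𝔨)) :=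
    JetAlgebra.gaugeEquivalent_of_ev₀_eq hv hσ (JetAlgebra.maurerCartan_const v σ₀) fun p ↦
      (JetAlgebra.ev₀_const (σ₀ p)).symm
  refine ⟨⟨σ₀, rfl, gauge_σ₀⟩, fun h𝔨 h𝔭 ↦ ?_⟩
  have σ₀_eq_zero : (σ₀ : 𝔭 →ₗ[ℝ] 𝔨) = 0 := by
    rw [h𝔨.lieHom_eq_zero h𝔭 σ₀]
    rfl
  rwa [σ₀_eq_zero, LinearMap.comp_zero] at gauge_σ₀

theorem mainTheorem7 {ι : Type*} [Finite ι]
    {𝔨 : Type*} [LieRing 𝔨] [LieAlgebra ℝ 𝔨] [FiniteDimensional ℝ 𝔨]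
    [LieAlgebra.IsSimple ℝ 𝔨] (h𝔨 : JetAlgebra.IsCompactLieAlgebra 𝔨)
    {𝔭 : Type*} [LieRing 𝔭] [LieAlgebra ℝ 𝔭] [FiniteDimensional ℝ 𝔭]
    [LieAlgebra.IsSemisimple ℝ 𝔭]
    (v : 𝔭 →ₗ[ℝ] JetAlgebra.VectorFields ι) (hv : ∀ p q : 𝔭, v ⁅p, q⁆ = ⁅v q, v p⁆)
    (σ : 𝔭 →ₗ[ℝ] JetAlgebra.Jet ι 𝔨) (hσ : JetAlgebra.MaurerCartan v σ) :
    (∃ σ₀ : 𝔭 →ₗ⁅ℝ⁆ 𝔨, (σ₀ : 𝔭 →ₗ[ℝ] 𝔨) = JetAlgebra.ev₀ ∘ₗ σ ∧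
      JetAlgebra.GaugeEquivalent v σ (JetAlgebra.const ∘ₗ (σ₀ : 𝔭 →ₗ[ℝ] 𝔨))) ∧
    ((∀ J : LieIdeal ℝ 𝔭, JetAlgebra.IsCompactLieAlgebra J → J = ⊥) →
      JetAlgebra.GaugeEquivalent v σ 0) :=
  (mainTheorem7_general v hv σ hσ).imp_right fun gauge_zero ↦ gauge_zero h𝔨
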